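/- Let $\mathscr{A}$ be an abelian category with enough projective and enough injective objects in which arbitrary (set-indexed) direct sums and products exist and are exact (AB4 and AB4$^*$). All subcategories are full and closed under isomorphisms. Let $\mathcal{P}(\mathscr{A})$ and $\mathcal{I}(\mathscr{A})$ be the subcategories of projective and of injective objects. For a subcategory $\mathscr{X}$ of $\mathscr{A}$ and $M\in\mathscr{A}$, let $\mathscr{X}\text{-}\mathrm{pd}\,M$ (resp. $\mathscr{X}\text{-}\mathrm{id}\,M$) be the infimum of the integers $n\ge 0$ for which there is an exact sequence $0\to X_n\to\cdots\to X_0\to M\to 0$ (resp. $0\to M\to X^0\to\cdots\to X^n\to 0$) with all terms $X_i$ (resp. $X^i$) in $\mathscr{X}$, and $\infty$ if there is none. For a subcategory $\mathscr{Y}$, $\mathscr{X}\text{-}\mathrm{pd}\,\mathscr{Y}$ and $\mathscr{X}\text{-}\mathrm{id}\,\mathscr{Y}$ are the suprema of these dimensions over the objects of $\mathscr{Y}$; $\mathscr{X}\text{-}\mathrm{pd}^{\le n}$ and $\mathscr{X}\text{-}\mathrm{id}^{\le n}$ are the subcategories of the objects of dimension at most $n$. Write $\mathrm{pd}$ for $\mathcal{P}(\mathscr{A})\text{-}\mathrm{pd}$.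 Let $\mathscr{X}^{\perp}=\{M\mid \mathrm{Ext}^i_{\mathscr{A}}(X,M)=0\text{ for all }X\in\mathscr{X},\ i\ge 1\}$. Let $\mathscr{C}$ and $\mathscr{D}$ be subcategories of $\mathscr{A}$, where $\mathscr{C}$ is additive (closed under finite direct sums, the zero object included) and closed under direct summands. The left Gorenstein subcategory $l\mathcal{G}(\mathscr{C},\mathscr{D})$ consists of the objects $M\in\mathscr{D}^{\perp}$ for which there is an exact sequence $\cdots\to C_1\to C_0\to M\to 0$ with all $C_i\in\mathscr{C}$ that remains exact under $\mathrm{Hom}_{\mathscr{A}}(D,-)$ for every $D\in\mathscr{D}$. Assume $\mathscr{C}\subseteq\mathscr{D}\cap\mathscr{D}^{\perp}$ and $\mathcal{I}(\mathscr{A})\subseteq l\mathcal{G}(\mathscr{C},\mathscr{D})$, and let $n\ge 0$. Consider the following conditions. 1. $\mathscr{A}$ is left $n$-$(\mathscr{C},\mathscr{D})$-Gorenstein, that is, $\mathscr{C}\text{-}\mathrm{id}\,\mathcal{P}(\mathscr{A})\le n$ and $\mathrm{pd}\,\mathscr{D}\le n$. 2. $l\mathcal{G}(\mathscr{C},\mathscr{D})\text{-}\mathrm{id}\,M\le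 n$ for every $M\in\mathscr{A}$. 3. $l\mathcal{G}(\mathscr{C},\mathscr{D})\text{-}\mathrm{id}\,\mathcal{P}(\mathscr{A})\le n$ and $\mathrm{pd}\,\mathscr{D}\le n$. 4. $\mathscr{D}\text{-}\mathrm{id}^{\le n}=\mathrm{pd}^{\le n}=\mathscr{C}\text{-}\mathrm{id}^{\le n}$. 5. $\mathscr{D}\text{-}\mathrm{id}^{\le n}\subseteq\mathrm{pd}^{\le n}\subseteq l\mathcal{G}(\mathscr{C},\mathscr{D})\text{-}\mathrm{id}^{\le n}$. Then $(4)\Rightarrow(1)\Leftrightarrow(2)\Leftrightarrow(3)\Leftarrow(5)$. Moreover: (i) If $\mathscr{C}$ is closed under cokernels of monomorphisms (for every short exact sequence $0\to X\to Y\to Z\to 0$ with $X,Y\in\mathscr{C}$ also $Z\in\mathscr{C}$), then (1)–(4) are equivalent. (ii) If $l\mathcal{G}(\mathscr{C},\mathscr{D})$ is preenveloping (every $M\in\mathscr{A}$ has a morphism $M\to X$ to an object $X$ of it through which every morphism from $M$ to an object of it factors) and coresolving (it contains $\mathcal{I}(\mathscr{A})$ and is closed under extensions and cokernels of monomorphisms),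 then (1)–(3) and (5) are equivalent. -/

import Mathlib

open CategoryTheory CategoryTheory.Limits

universe v u

namespace RelativeGorenstein

variable {A : Type u} [Category.{v} A] [Abelian A]

/-- An exact sequence `⋯ ⟶ X 2 ⟶ X 1 ⟶ X 0 ⟶ M ⟶ 0`. -/
structure LeftResolution (M : A) where
  X : ℕ → A
  d : ∀ i, X (i + 1) ⟶ X i
  π : X 0 ⟶ M
  d_comp_π : d 0 ≫ π = 0
  d_comp_d : ∀ i, d (i + 1) ≫ d i = 0
  epi_π : Epi π
  exact_zero : (ShortComplex.mk (d 0) π d_comp_π).Exact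
  exact_succ : ∀ i, (ShortComplex.mk (d (i + 1)) (d i) (d_comp_d i)).Exact

/-- An exact sequence `0 ⟶ M ⟶ X 0 ⟶ X 1 ⟶ X 2 ⟶ ⋯`. -/
structure RightResolution (M : A) where
  X : ℕ → A
  d : ∀ i, X i ⟶ X (i + 1)
  ι : M ⟶ X 0
  ι_comp_d : ι ≫ d 0 = 0
  d_comp_d : ∀ i, d i ≫ d (i + 1) = 0
  mono_ι : Mono ι
  exact_zero : (ShortComplex.mk ι (d 0) ι_comp_d).Exact
  exact_succ : ∀ i, (ShortComplex.mk (d i) (d (i + 1)) (d_comp_d i)).Exact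

/-- There is an exact sequence `0 ⟶ X n ⟶ ⋯ ⟶ X 0 ⟶ M ⟶ 0` with all terms `X i` in `P`
(the infinite sequence vanishes in degrees above `n`). -/
def HasLeftResolutionOfLength (P : ObjectProperty A) (M : A) (n : ℕ) : Prop :=
  ∃ R : LeftResolution M, (∀ i ≤ n, P (R.X i)) ∧ ∀ i, n < i → IsZero (R.X i)

/-- There is an exact sequence `0 ⟶ M ⟶ X 0 ⟶ ⋯ ⟶ X n ⟶ 0` with all terms `X i` in `P`
(the infinite sequence vanishes in degrees above `n`). -/
def HasRightResolutionOfLength (P : ObjectProperty A) (M : A) (n : ℕ) : Prop :=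
  ∃ R : RightResolution M, (∀ i ≤ n, P (R.X i)) ∧ ∀ i, n < i → IsZero (R.X i)

/-- The `P`-projective dimension of an object; it is `⊤` if there is no finite resolution. -/
noncomputable def projDim (P : ObjectProperty A) (M : A) : ℕ∞ :=
  ⨅ (n : ℕ) (_ : HasLeftResolutionOfLength P M n), (n : ℕ∞)

/-- The `P`-injective dimension of an object; it is `⊤` if there is no finite resolution. -/
noncomputable def injDim (P : ObjectProperty A) (M : A) : ℕ∞ :=
  ⨅ (n : ℕ) (_ : HasRightResolutionOfLength P M n), (n : ℕ∞)

/-- The supremum of the `P`-projective dimensions of the objects in `Q`. -/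
noncomputable def projDimOf (P Q : ObjectProperty A) : ℕ∞ :=
  ⨆ (M : A) (_ : Q M), projDim P M

/-- The supremum of the `P`-injective dimensions of the objects in `Q`. -/
noncomputable def injDimOf (P Q : ObjectProperty A) : ℕ∞ :=
  ⨆ (M : A) (_ : Q M), injDim P M

/-- The objects of `P`-projective dimension at most `n`. -/
def projDimLE (P : ObjectProperty A) (n : ℕ) : ObjectProperty A :=
  fun M => projDim P M ≤ (n : ℕ∞)

/-- The objects of `P`-injective dimension at most `n`. -/
def injDimLE (P : ObjectProperty A) (n : ℕ) : ObjectProperty A :=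
  fun M => injDim P M ≤ (n : ℕ∞)

/-- The right orthogonal class: all `M` with `Ext^i(X, M) = 0` for all `X` in `P`, `i ≥ 1`. -/
def rightOrth (P : ObjectProperty A) : ObjectProperty A :=
  fun M => letI := HasExt.standard A
    ∀ X : A, P X → ∀ i : ℕ, 1 ≤ i → Subsingleton (Abelian.Ext.{max u v} X M i)

/-- The sequence `⋯ ⟶ X 1 ⟶ X 0 ⟶ M ⟶ 0` remains exact after applying `Hom(Y, -)` for
every `Y` in `P`. -/
def LeftResolution.IsHomExact {M : A} (R : LeftResolution M) (P : ObjectProperty A) : Prop :=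
  ∀ Y : A, P Y →
    Function.Surjective (fun f : Y ⟶ R.X 0 => f ≫ R.π) ∧
    Function.Exact (fun f : Y ⟶ R.X 1 => f ≫ R.d 0) (fun f : Y ⟶ R.X 0 => f ≫ R.π) ∧
    ∀ i, Function.Exact (fun f : Y ⟶ R.X (i + 2) => f ≫ R.d (i + 1))
      (fun f : Y ⟶ R.X (i + 1) => f ≫ R.d i)

/-- The objects `M` having a `Hom(D, -)`-exact exact sequence `⋯ ⟶ X 1 ⟶ X 0 ⟶ M ⟶ 0`
with all `X i` in `C`. -/
def properRes (D C : ObjectProperty A) : ObjectProperty A :=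
  fun M => ∃ R : LeftResolution M, (∀ i, C (R.X i)) ∧ R.IsHomExact D

/-- The left Gorenstein subcategory relative to `C` and `D`. -/
def leftGorenstein (C D : ObjectProperty A) : ObjectProperty A :=
  rightOrth D ⊓ properRes D C

/-- `P` is closed under cokernels of monomorphisms between its objects. -/
def ClosedUnderCokernelsOfMonos (P : ObjectProperty A) : Prop :=
  ∀ S : ShortComplex A, S.ShortExact → P S.X₁ → P S.X₂ → P S.X₃

/-- `P` contains the injective objects and is closed under extensions and cokernels of
monomorphisms. -/
structure IsCoresolving (P : ObjectProperty A) : Prop where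
  injective_le : isInjective A ≤ P
  extensions : P.IsClosedUnderExtensions
  cokernels : ClosedUnderCokernelsOfMonos P

/-- A `P`-preenvelope of `M`: a morphism from `M` to an object of `P` through which all
morphisms from `M` to objects of `P` factor. -/
def IsPreenvelope (P : ObjectProperty A) {M X : A} (f : M ⟶ X) : Prop :=
  P X ∧ ∀ X' : A, P X' → Function.Surjective (fun g : X ⟶ X' => f ≫ g)

/-- Every object has a `P`-preenvelope. -/
def IsPreenveloping (P : ObjectProperty A) : Prop :=
  ∀ M : A, ∃ (X : A) (f : M ⟶ X), IsPreenvelope P f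

/-- The ambient category is left `n`-`(C, D)`-Gorenstein. -/
def IsLeftGorensteinCategory (n : ℕ) (C D : ObjectProperty A) : Prop :=
  injDimOf C (isProjective A) ≤ (n : ℕ∞) ∧
    projDimOf (isProjective A) D ≤ (n : ℕ∞)

end RelativeGorenstein

open scoped ZeroObject

namespace RelativeGorenstein

variable {A : Type u} [Category.{v} A] [Abelian A]

/-! Write G for `leftGorenstein C D`. Dimension at most n is encoded by iterated short exact
sequences. Membership in G is coinductive: a class inside the right orthogonal of D lies in G as
soon as each member is a quotient of an object of C by another member (`le_leftGorenstein`), and G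
itself is such a class (`leftGorenstein.exists_ses`). Objects with a finite C-coresolution have no
positive Ext into G, so the extensions met in horseshoe arguments split and can be reversed; hence G
is closed under extensions.

(1) ⇒ (2): embed n times into injectives, which lie in G. The class of n-th cosyzygies is orthogonal
to D because pd D ≤ n, and each member is a quotient of an object of C by another member because
projectives have C-coresolutions of length n (`exists_ses_of_cosyzygy`). So n-th cosyzygies lie in
G.

(2) ⇒ (3): dimension shifting gives Ext^{n+1}(Y, -) = 0 for Y in D.

(3) ⇒ (1): a projective P is a quotient, with kernel in G, of an object with a short C-coresolution.
This quotient splits, which forces the kernel into C and gives P a C-coresolution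
(`coresolutionLE_of_projective`).

Conditions (4) and (5) enter through inclusions of classes: objects of D-injective dimension at most
n have projective dimension at most n by dimension shifting, and closure of C under cokernels turns
projective resolutions into C-coresolutions. -/

/-- There is a short exact sequence `0 ⟶ X ⟶ Y ⟶ Z ⟶ 0`. -/
def SES (X Y Z : A) : Prop :=
  ∃ (i : X ⟶ Y) (p : Y ⟶ Z) (w : i ≫ p = 0), (ShortComplex.mk i p w).ShortExact

lemma shortExact_of_lift {X Y Z : A} (i : X ⟶ Y) (p : Y ⟶ Z) (w : i ≫ p = 0) [Mono i] [Epi p]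
    (h : ∀ {T : A} (f : T ⟶ Y), f ≫ p = 0 → ∃ g : T ⟶ X, g ≫ i = f) :
    (ShortComplex.mk i p w).ShortExact := by
  refine ShortComplex.ShortExact.mk' (ShortComplex.exact_of_f_is_kernel _
    (KernelFork.IsLimit.ofι _ _ (fun f hf => (h f hf).choose)
      (fun f hf => (h f hf).choose_spec) fun f hf m hm => ?_)) inferInstance inferInstance
  rw [← cancel_mono i]
  exact hm.trans (h f hf).choose_spec.symm

lemma shortExact_of_desc {X Y Z : A} (i : X ⟶ Y) (p : Y ⟶ Z) (w : i ≫ p = 0) [Mono i] [Epi p]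
    (h : ∀ {T : A} (f : Y ⟶ T), i ≫ f = 0 → ∃ g : Z ⟶ T, p ≫ g = f) :
    (ShortComplex.mk i p w).ShortExact := by
  refine ShortComplex.ShortExact.mk' (ShortComplex.exact_of_g_is_cokernel _
    (CokernelCofork.IsColimit.ofπ _ _ (fun f hf => (h f hf).choose)
      (fun f hf => (h f hf).choose_spec) fun f hf m hm => ?_)) inferInstance inferInstance
  rw [← cancel_epi p]
  exact hm.trans (h f hf).choose_spec.symm

/-! ### Base change and cobase change of short exact sequences -/

section Diagrams

variable {X Y Z : A} {i : X ⟶ Y} {p : Y ⟶ Z} {w : i ≫ p = 0}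

lemma exists_lift_of_shortExact (h : (ShortComplex.mk i p w).ShortExact) {T : A} (f : T ⟶ Y)
    (hf : f ≫ p = 0) : ∃ g : T ⟶ X, g ≫ i = f := by
  have := h.mono_f
  exact ⟨h.exact.lift f hf, h.exact.lift_f f hf⟩

lemma exists_desc_of_shortExact (h : (ShortComplex.mk i p w).ShortExact) {T : A} (f : Y ⟶ T)
    (hf : i ≫ f = 0) : ∃ g : Z ⟶ T, p ≫ g = f := by
  have := h.epi_g
  exact ⟨h.exact.desc f hf, h.exact.g_desc f hf⟩

lemma shortExact_pullback (h : (ShortComplex.mk i p w).ShortExact) {Z' : A} (f : Z' ⟶ Z) :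
    SES X (pullback p f) Z' := by
  have : Mono i := h.mono_f
  have : Epi p := h.epi_g
  obtain ⟨l, hl, hl'⟩ : ∃ l : X ⟶ pullback p f, l ≫ pullback.fst p f = i ∧
      l ≫ pullback.snd p f = 0 :=
    ⟨pullback.lift i 0 (by simp [w]), pullback.lift_fst _ _ _, pullback.lift_snd _ _ _⟩
  have : Mono l := mono_of_mono_fac hl
  refine ⟨l, pullback.snd p f, hl', shortExact_of_lift _ _ _ fun {T} g hg => ?_⟩
  obtain ⟨k, hk⟩ := exists_lift_of_shortExact h (g ≫ pullback.fst p f)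
    (by rw [Category.assoc, pullback.condition, reassoc_of% hg, zero_comp])
  exact ⟨k, by ext <;> simp [hk, hg, hl, hl']⟩

lemma shortExact_pushout (h : (ShortComplex.mk i p w).ShortExact) {X' : A} (f : X ⟶ X') :
    SES X' (pushout i f) Z := by
  have : Mono i := h.mono_f
  have : Epi p := h.epi_g
  obtain ⟨l, hl, hl'⟩ : ∃ l : pushout i f ⟶ Z, pushout.inl i f ≫ l = p ∧
      pushout.inr i f ≫ l = 0 :=
    ⟨pushout.desc p 0 (by simp [w]), pushout.inl_desc _ _ _, pushout.inr_desc _ _ _⟩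
  have : Epi l := epi_of_epi_fac hl
  refine ⟨pushout.inr i f, l, hl', shortExact_of_desc _ _ _ fun {T} g hg => ?_⟩
  obtain ⟨k, hk⟩ := exists_desc_of_shortExact h (pushout.inl i f ≫ g)
    (by rw [pushout.condition_assoc, hg, comp_zero])
  exact ⟨k, by ext <;> simp [hk, hg, reassoc_of% hl, reassoc_of% hl']⟩

end Diagrams

/-! ### Calculus of short exact sequences -/

namespace SES

variable {X Y Z : A}

lemma of_iso_mid {Y' : A} (h : SES X Y Z) (e : Y ≅ Y') : SES X Y' Z := by
  obtain ⟨i, p, w, h⟩ := h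
  refine ⟨i ≫ e.hom, e.inv ≫ p, by simpa using w, ShortComplex.shortExact_of_iso
    (ShortComplex.isoMk (S₁ := .mk i p w) (Iso.refl _) e (Iso.refl _) ?_ ?_) h⟩ <;> simp

/-- Kernels are preserved by base change, applied to each leg of the square. This square and its
three variants below carry the later horseshoe arguments. -/
lemma pullback_epi {X' Y' : A} (h : SES X Y Z) (h' : SES X' Y' Z) :
    ∃ E : A, SES X E Y' ∧ SES X' E Y := by
  obtain ⟨i, p, w, h⟩ := h
  obtain ⟨i', p', w', h'⟩ := h'
  exact ⟨pullback p p', shortExact_pullback h p',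
    (shortExact_pullback h' p).of_iso_mid (pullbackSymmetry p' p)⟩

lemma pushout_mono {Y' Z' : A} (h : SES X Y Z) (h' : SES X Y' Z') :
    ∃ E : A, SES Y E Z' ∧ SES Y' E Z := by
  obtain ⟨i, p, w, h⟩ := h
  obtain ⟨i', p', w', h'⟩ := h'
  exact ⟨pushout i i', (shortExact_pushout h' i).of_iso_mid (pushoutSymmetry i' i),
    shortExact_pushout h i'⟩

lemma pullback_mono {Z' Q : A} (h : SES X Y Z) (h' : SES Z' Z Q) :
    ∃ E : A, SES X E Z' ∧ SES E Y Q := by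
  obtain ⟨i, p, w, h⟩ := h
  obtain ⟨f, q, w', h'⟩ := h'
  have : Epi p := h.epi_g
  have : Epi q := h'.epi_g
  have : Mono f := h'.mono_f
  refine ⟨pullback p f, shortExact_pullback h f, pullback.fst p f, p ≫ q,
    by rw [pullback.condition_assoc, w', comp_zero], shortExact_of_lift _ _ _ fun {T} g hg => ?_⟩
  obtain ⟨k, hk⟩ := exists_lift_of_shortExact h' (g ≫ p) (by simpa using hg)
  exact ⟨pullback.lift g k hk.symm, pullback.lift_fst _ _ _⟩

lemma pushout_epi {X' K : A} (h : SES X Y Z) (h' : SES K X X') :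
    ∃ E : A, SES X' E Z ∧ SES K Y E := by
  obtain ⟨i, p, w, h⟩ := h
  obtain ⟨j, f, w', h'⟩ := h'
  have : Mono i := h.mono_f
  have : Epi f := h'.epi_g
  have : Mono j := h'.mono_f
  refine ⟨pushout i f, shortExact_pushout h f, j ≫ i, pushout.inl i f,
    by rw [Category.assoc, pushout.condition, reassoc_of% w', zero_comp],
    shortExact_of_desc _ _ _ fun {T} g hg => ?_⟩
  obtain ⟨k, hk⟩ := exists_desc_of_shortExact h' (i ≫ g) (by simpa using hg)
  exact ⟨pushout.desc g k hk.symm, pushout.inl_desc _ _ _⟩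

lemma of_splitting {i : X ⟶ Y} {p : Y ⟶ Z} {w : i ≫ p = 0}
    (s : (ShortComplex.mk i p w).Splitting) : SES Z Y X := by
  have := s.isSplitMono_f
  have h₁ : s.s ≫ p = 𝟙 Z := s.s_g
  have h₂ : i ≫ s.r = 𝟙 X := s.f_r
  have h₃ : s.r ≫ i + p ≫ s.s = 𝟙 Y := s.id
  have h₄ : s.s ≫ s.r = 0 := s.s_r
  exact ⟨s.s, s.r, h₄, ShortComplex.Splitting.shortExact
    { r := p, s := i, f_r := h₁, s_g := h₂, id := by rw [add_comm]; exact h₃ }⟩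

lemma of_isZero_left (hX : IsZero X) (e : Y ≅ Z) : SES X Y Z :=
  have : Mono (0 : X ⟶ Y) := ⟨fun _ _ _ => hX.eq_of_tgt _ _⟩
  ⟨0, e.hom, zero_comp, shortExact_of_lift _ _ _ fun f hf => ⟨0, by
    rw [← cancel_mono e.hom, hf]; simp⟩⟩

lemma of_isZero_right (hZ : IsZero Z) (e : X ≅ Y) : SES X Y Z :=
  have : Epi (0 : Y ⟶ Z) := ⟨fun _ _ _ => hZ.eq_of_src _ _⟩
  ⟨e.hom, 0, comp_zero, shortExact_of_lift _ _ _ fun f _ => ⟨f ≫ e.inv, by simp⟩⟩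

lemma of_mono (f : X ⟶ Y) [Mono f] : SES X Y (cokernel f) :=
  ⟨f, cokernel.π f, cokernel.condition f, shortExact_of_desc _ _ _ fun g hg =>
    ⟨cokernel.desc f g hg, cokernel.π_desc _ _ _⟩⟩

lemma of_epi (f : Y ⟶ Z) [Epi f] : SES (kernel f) Y Z :=
  ⟨kernel.ι f, f, kernel.condition f, shortExact_of_lift _ _ _ fun g hg =>
    ⟨kernel.lift f g hg, kernel.lift_ι _ _ _⟩⟩

end SES

/-! ### Vanishing of Ext along short exact sequences -/

section Ext

open Abelian

attribute [local instance] HasExt.standard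

/-- `Ext^i(Y, M) = 0`. -/
abbrev ExtVanishes (Y M : A) (i : ℕ) : Prop := Subsingleton (Ext.{max u v} Y M i)

variable {X Y Z : A}

lemma SES.ext_vanishes_mid (h : SES X Y Z) {T : A} {i : ℕ} (h₁ : ExtVanishes T X i)
    (h₃ : ExtVanishes T Z i) : ExtVanishes T Y i := by
  obtain ⟨f, g, w, h⟩ := h
  refine subsingleton_of_forall_eq 0 fun x => ?_
  obtain ⟨y, rfl⟩ := Ext.covariant_sequence_exact₂ T h x (Subsingleton.elim _ _)
  rw [Subsingleton.elim y 0, Ext.zero_comp]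

lemma SES.ext_vanishes_right (h : SES X Y Z) {T : A} {i : ℕ} (h₂ : ExtVanishes T Y i)
    (h₁ : ExtVanishes T X (i + 1)) : ExtVanishes T Z i := by
  obtain ⟨f, g, w, h⟩ := h
  refine subsingleton_of_forall_eq 0 fun x => ?_
  obtain ⟨y, rfl⟩ := Ext.covariant_sequence_exact₃ T h x rfl (Subsingleton.elim _ _)
  rw [Subsingleton.elim y 0, Ext.zero_comp]

lemma SES.ext_vanishes_left (h : SES X Y Z) {T : A} {i : ℕ} (h₃ : ExtVanishes T Z i)
    (h₂ : ExtVanishes T Y (i + 1)) : ExtVanishes T X (i + 1) := by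
  obtain ⟨f, g, w, h⟩ := h
  refine subsingleton_of_forall_eq 0 fun x => ?_
  obtain ⟨y, rfl⟩ := Ext.covariant_sequence_exact₁ T h x (Subsingleton.elim _ _) rfl
  rw [Subsingleton.elim y 0, Ext.zero_comp]

lemma SES.ext_vanishes_left' (h : SES X Y Z) {T : A} {i : ℕ} (h₂ : ExtVanishes Y T i)
    (h₃ : ExtVanishes Z T (i + 1)) : ExtVanishes X T i := by
  obtain ⟨f, g, w, h⟩ := h
  refine subsingleton_of_forall_eq 0 fun x => ?_
  obtain ⟨y, rfl⟩ := Ext.contravariant_sequence_exact₁ h T x (add_comm 1 i)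
    (Subsingleton.elim _ _)
  rw [Subsingleton.elim y 0, Ext.comp_zero]

lemma SES.ext_vanishes_right' (h : SES X Y Z) {T : A} {i : ℕ} (h₁ : ExtVanishes X T i)
    (h₂ : ExtVanishes Y T (i + 1)) : ExtVanishes Z T (i + 1) := by
  obtain ⟨f, g, w, h⟩ := h
  refine subsingleton_of_forall_eq 0 fun x => ?_
  obtain ⟨y, rfl⟩ := Ext.contravariant_sequence_exact₃ h T x (Subsingleton.elim _ _)
    (add_comm 1 i)
  rw [Subsingleton.elim y 0, Ext.comp_zero]

lemma extVanishes_of_projective (P T : A) [Projective P] (i : ℕ) : ExtVanishes P T (i + 1) :=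
  subsingleton_of_forall_eq 0 fun x => Ext.eq_zero_of_projective x

lemma exists_lift_of_extVanishes {i : X ⟶ Y} {p : Y ⟶ Z} {w : i ≫ p = 0}
    (h : (ShortComplex.mk i p w).ShortExact) {T : A} (hT : ExtVanishes T X 1) (f : T ⟶ Z) :
    ∃ g : T ⟶ Y, g ≫ p = f := by
  obtain ⟨x, hx⟩ := Ext.covariant_sequence_exact₃ T h (Ext.mk₀ f) rfl (Subsingleton.elim _ _)
  obtain ⟨g, rfl⟩ := (Ext.mk₀_bijective _ _).2 x
  exact ⟨g, (Ext.mk₀_bijective _ _).1 ((Ext.mk₀_comp_mk₀ _ _).symm.trans hx)⟩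

/-- The sequence splits, so it may be read backwards; the reversed sequence can then be pushed out
or pulled back on the other side. -/
lemma SES.symm_of_extVanishes (h : SES X Y Z) (hZX : ExtVanishes Z X 1) : SES Z Y X := by
  obtain ⟨i, p, w, h⟩ := h
  obtain ⟨s, hs⟩ := exists_lift_of_extVanishes h hZX (𝟙 Z)
  have := h.mono_f
  exact of_splitting (ShortComplex.Splitting.ofExactOfSection _ h.exact s hs h.mono_f)

end Ext

/-! ### Resolutions as iterated short exact sequences -/

/-- The objects with a `P`-coresolution of length at most `n`, in terms of iterated short exact
sequences. -/
def coresolutionLE (P : ObjectProperty A) : ℕ → ObjectProperty A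
  | 0 => P
  | n + 1 => fun M => ∃ X Z : A, SES M X Z ∧ P X ∧ coresolutionLE P n Z

/-- The objects with a `P`-resolution of length at most `n`, in terms of iterated short exact
sequences. -/
def resolutionLE (P : ObjectProperty A) : ℕ → ObjectProperty A
  | 0 => P
  | n + 1 => fun M => ∃ K X : A, SES K X M ∧ P X ∧ resolutionLE P n K

lemma exact_comp_of_epi {X Y Z T : A} {e : T ⟶ X} [Epi e] {f : X ⟶ Y} {g : Y ⟶ Z}
    {w : f ≫ g = 0} {w' : (e ≫ f) ≫ g = 0} :
    (ShortComplex.mk (e ≫ f) g w').Exact ↔ (ShortComplex.mk f g w).Exact := by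
  let φ : ShortComplex.mk (e ≫ f) g w' ⟶ ShortComplex.mk f g w :=
    { τ₁ := e, τ₂ := 𝟙 _, τ₃ := 𝟙 _ }
  have : Epi φ.τ₁ := inferInstanceAs (Epi e)
  have : IsIso φ.τ₂ := inferInstanceAs (IsIso (𝟙 Y))
  have : Mono φ.τ₃ := inferInstanceAs (Mono (𝟙 Z))
  exact ShortComplex.exact_iff_of_epi_of_isIso_of_mono φ

lemma exact_comp_of_mono {X Y Z T : A} {f : X ⟶ Y} {g : Y ⟶ Z} {m : Z ⟶ T} [Mono m]
    {w : f ≫ g = 0} {w' : f ≫ g ≫ m = 0} :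
    (ShortComplex.mk f (g ≫ m) w').Exact ↔ (ShortComplex.mk f g w).Exact := by
  let φ : ShortComplex.mk f g w ⟶ ShortComplex.mk f (g ≫ m) w' :=
    { τ₁ := 𝟙 _, τ₂ := 𝟙 _, τ₃ := m }
  have : Epi φ.τ₁ := inferInstanceAs (Epi (𝟙 X))
  have : IsIso φ.τ₂ := inferInstanceAs (IsIso (𝟙 Y))
  have : Mono φ.τ₃ := inferInstanceAs (Mono m)
  exact (ShortComplex.exact_iff_of_epi_of_isIso_of_mono φ).symm

namespace RightResolution

/-- The resolution of the zero object. -/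
def ofIsZero {M : A} (hM : IsZero M) : RightResolution M where
  X _ := M
  d _ := 0
  ι := 0
  ι_comp_d := zero_comp
  d_comp_d _ := zero_comp
  mono_ι := ⟨fun _ _ _ => hM.eq_of_tgt _ _⟩
  exact_zero := ShortComplex.exact_of_isZero_X₂ _ hM
  exact_succ _ := ShortComplex.exact_of_isZero_X₂ _ hM

/-- Splice a short exact sequence with a resolution of its last term. -/
def cons {M X Z : A} (i : M ⟶ X) (p : X ⟶ Z) (w : i ≫ p = 0)
    (h : (ShortComplex.mk i p w).ShortExact) (R : RightResolution Z) : RightResolution M where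
  X k := match k with
    | 0 => X
    | k + 1 => R.X k
  d k := match k with
    | 0 => p ≫ R.ι
    | k + 1 => R.d k
  ι := i
  ι_comp_d := by rw [reassoc_of% w, zero_comp]
  d_comp_d k := match k with
    | 0 => by rw [Category.assoc, R.ι_comp_d, comp_zero]
    | k + 1 => R.d_comp_d k
  mono_ι := h.mono_f
  exact_zero := by
    have := R.mono_ι
    exact exact_comp_of_mono.2 h.exact
  exact_succ k := match k with
    | 0 => by
      have : Epi p := h.epi_g
      exact exact_comp_of_epi.2 R.exact_zero
    | k + 1 => R.exact_succ k

lemma π_comp_desc {M : A} (R : RightResolution M) :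
    cokernel.π R.ι ≫ cokernel.desc R.ι (R.d 0) R.ι_comp_d = R.d 0 :=
  cokernel.π_desc _ _ _

/-- The resolution of the first cosyzygy. -/
noncomputable def tail {M : A} (R : RightResolution M) : RightResolution (cokernel R.ι) where
  X k := R.X (k + 1)
  d k := R.d (k + 1)
  ι := cokernel.desc R.ι (R.d 0) R.ι_comp_d
  ι_comp_d := by
    rw [← cancel_epi (cokernel.π R.ι), reassoc_of% R.π_comp_desc, R.d_comp_d, comp_zero]
  d_comp_d k := R.d_comp_d (k + 1)
  mono_ι := R.exact_zero.mono_cokernelDesc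
  exact_zero := by
    rw [← exact_comp_of_epi (e := cokernel.π R.ι)
      (w' := by rw [R.π_comp_desc, R.d_comp_d])]
    simp only [R.π_comp_desc]
    exact R.exact_succ 0
  exact_succ k := R.exact_succ (k + 1)

lemma ses {M : A} (R : RightResolution M) : SES M (R.X 0) (cokernel R.ι) :=
  have := R.mono_ι
  SES.of_mono R.ι

end RightResolution

namespace LeftResolution

/-- The resolution of the zero object. -/
def ofIsZero {M : A} (hM : IsZero M) : LeftResolution M where
  X _ := M
  d _ := 0
  π := 0
  d_comp_π := zero_comp
  d_comp_d _ := zero_comp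
  epi_π := ⟨fun _ _ _ => hM.eq_of_src _ _⟩
  exact_zero := ShortComplex.exact_of_isZero_X₂ _ hM
  exact_succ _ := ShortComplex.exact_of_isZero_X₂ _ hM

/-- Splice a short exact sequence with a resolution of its first term. -/
def cons {K X M : A} (i : K ⟶ X) (p : X ⟶ M) (w : i ≫ p = 0)
    (h : (ShortComplex.mk i p w).ShortExact) (R : LeftResolution K) : LeftResolution M where
  X k := match k with
    | 0 => X
    | k + 1 => R.X k
  d k := match k with
    | 0 => R.π ≫ i
    | k + 1 => R.d k
  π := p
  d_comp_π := by rw [Category.assoc, w, comp_zero]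
  d_comp_d k := match k with
    | 0 => by rw [reassoc_of% R.d_comp_π, zero_comp]
    | k + 1 => R.d_comp_d k
  epi_π := h.epi_g
  exact_zero := by
    have := R.epi_π
    exact exact_comp_of_epi.2 h.exact
  exact_succ k := match k with
    | 0 => by
      have : Mono i := h.mono_f
      exact exact_comp_of_mono.2 R.exact_zero
    | k + 1 => R.exact_succ k

lemma lift_comp_ι {M : A} (R : LeftResolution M) :
    kernel.lift R.π (R.d 0) R.d_comp_π ≫ kernel.ι R.π = R.d 0 :=
  kernel.lift_ι _ _ _

/-- The resolution of the first syzygy. -/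
noncomputable def tail {M : A} (R : LeftResolution M) : LeftResolution (kernel R.π) where
  X k := R.X (k + 1)
  d k := R.d (k + 1)
  π := kernel.lift R.π (R.d 0) R.d_comp_π
  d_comp_π := by
    rw [← cancel_mono (kernel.ι R.π), Category.assoc, R.lift_comp_ι, R.d_comp_d, zero_comp]
  d_comp_d k := R.d_comp_d (k + 1)
  epi_π := R.exact_zero.epi_kernelLift
  exact_zero := by
    rw [← exact_comp_of_mono (m := kernel.ι R.π)
      (w' := by rw [R.lift_comp_ι, R.d_comp_d])]
    simp only [R.lift_comp_ι]
    exact R.exact_succ 0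
  exact_succ k := R.exact_succ (k + 1)

lemma ses {M : A} (R : LeftResolution M) : SES (kernel R.π) (R.X 0) M :=
  have := R.epi_π
  SES.of_epi R.π

end LeftResolution

/-! ### Dimensions in terms of iterated short exact sequences -/

section Dimension

variable {P : ObjectProperty A}

lemma HasRightResolutionOfLength.coresolutionLE [P.IsClosedUnderIsomorphisms] :
    ∀ {n : ℕ} {M : A}, HasRightResolutionOfLength P M n → coresolutionLE P n M
  | 0, M, ⟨R, hR, hR'⟩ => by
    have := R.mono_ι
    have : Epi R.ι := R.exact_zero.epi_f ((hR' 1 Nat.one_pos).eq_of_tgt _ _)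
    have : IsIso R.ι := isIso_of_mono_of_epi _
    exact P.prop_of_iso (asIso R.ι).symm (hR 0 le_rfl)
  | n + 1, M, ⟨R, hR, hR'⟩ =>
    ⟨_, _, R.ses, hR 0 (Nat.zero_le _), HasRightResolutionOfLength.coresolutionLE
      ⟨R.tail, fun i hi => hR (i + 1) (Nat.succ_le_succ hi),
        fun i hi => hR' (i + 1) (Nat.succ_lt_succ hi)⟩⟩

lemma hasRightResolutionOfLength_of_coresolutionLE :
    ∀ {n : ℕ} {M : A}, coresolutionLE P n M → HasRightResolutionOfLength P M n
  | 0, M, hM => by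
    obtain ⟨i, p, w, h⟩ := SES.of_isZero_right (isZero_zero A) (Iso.refl M)
    exact ⟨.cons i p w h (.ofIsZero (isZero_zero A)), fun
      | 0, _ => hM, fun
      | k + 1, _ => isZero_zero A⟩
  | n + 1, M, ⟨X, Z, ⟨i, p, w, h⟩, hX, hZ⟩ => by
    obtain ⟨R, hR, hR'⟩ := hasRightResolutionOfLength_of_coresolutionLE hZ
    exact ⟨.cons i p w h R, fun
      | 0, _ => hX
      | k + 1, hk => hR k (Nat.le_of_succ_le_succ hk), fun
      | k + 1, hk => hR' k (Nat.lt_of_succ_lt_succ hk)⟩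

lemma HasLeftResolutionOfLength.resolutionLE [P.IsClosedUnderIsomorphisms] :
    ∀ {n : ℕ} {M : A}, HasLeftResolutionOfLength P M n → resolutionLE P n M
  | 0, M, ⟨R, hR, hR'⟩ => by
    have := R.epi_π
    have : Mono R.π := R.exact_zero.mono_g ((hR' 1 Nat.one_pos).eq_of_src _ _)
    have : IsIso R.π := isIso_of_mono_of_epi _
    exact P.prop_of_iso (asIso R.π) (hR 0 le_rfl)
  | n + 1, M, ⟨R, hR, hR'⟩ =>
    ⟨_, _, R.ses, hR 0 (Nat.zero_le _), HasLeftResolutionOfLength.resolutionLE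
      ⟨R.tail, fun i hi => hR (i + 1) (Nat.succ_le_succ hi),
        fun i hi => hR' (i + 1) (Nat.succ_lt_succ hi)⟩⟩

lemma hasLeftResolutionOfLength_of_resolutionLE :
    ∀ {n : ℕ} {M : A}, resolutionLE P n M → HasLeftResolutionOfLength P M n
  | 0, M, hM => by
    obtain ⟨i, p, w, h⟩ := SES.of_isZero_left (isZero_zero A) (Iso.refl M)
    exact ⟨.cons i p w h (.ofIsZero (isZero_zero A)), fun
      | 0, _ => hM, fun
      | k + 1, _ => isZero_zero A⟩
  | n + 1, M, ⟨X, Z, ⟨i, p, w, h⟩, hX, hZ⟩ => by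
    obtain ⟨R, hR, hR'⟩ := hasLeftResolutionOfLength_of_resolutionLE hZ
    exact ⟨.cons i p w h R, fun
      | 0, _ => hX
      | k + 1, hk => hR k (Nat.le_of_succ_le_succ hk), fun
      | k + 1, hk => hR' k (Nat.lt_of_succ_lt_succ hk)⟩

variable (hP : ∀ M : A, IsZero M → P M)

include hP

lemma coresolutionLE_mono {n m : ℕ} (hnm : n ≤ m) : coresolutionLE P n ≤ coresolutionLE P m := by
  refine monotone_nat_of_le_succ (f := coresolutionLE P) (fun k => ?_) hnm
  induction k with
  | zero => exact fun M hM =>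
      ⟨M, 0, SES.of_isZero_right (isZero_zero A) (Iso.refl M), hM, hP _ (isZero_zero A)⟩
  | succ k ih => exact fun M ⟨X, Z, h, hX, hZ⟩ => ⟨X, Z, h, hX, ih _ hZ⟩

lemma resolutionLE_mono {n m : ℕ} (hnm : n ≤ m) : resolutionLE P n ≤ resolutionLE P m := by
  refine monotone_nat_of_le_succ (f := resolutionLE P) (fun k => ?_) hnm
  induction k with
  | zero => exact fun M hM =>
      ⟨0, M, SES.of_isZero_left (isZero_zero A) (Iso.refl M), hM, hP _ (isZero_zero A)⟩
  | succ k ih => exact fun M ⟨X, Z, h, hX, hZ⟩ => ⟨X, Z, h, hX, ih _ hZ⟩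

variable [P.IsClosedUnderIsomorphisms]

lemma injDim_le_iff (M : A) (n : ℕ) : injDim P M ≤ n ↔ coresolutionLE P n M := by
  refine ⟨fun h => ?_, fun h =>
    iInf₂_le (f := fun (n : ℕ) (_ : HasRightResolutionOfLength P M n) => (n : ℕ∞)) n
      (hasRightResolutionOfLength_of_coresolutionLE h)⟩
  -- If every available length exceeded n, the infimum would be at least n + 1. A shorter
  -- coresolution is then padded with zero objects, which lie in P.
  obtain ⟨m, hm, hmn⟩ : ∃ m, HasRightResolutionOfLength P M m ∧ m ≤ n := by
    by_contra! h'
    have : ((n + 1 : ℕ) : ℕ∞) ≤ injDim P M :=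
      le_iInf₂ fun m hm => Nat.cast_le.2 (h' m hm)
    exact absurd (Nat.cast_le.1 (this.trans h)) (Nat.not_succ_le_self n)
  exact coresolutionLE_mono hP hmn _ hm.coresolutionLE

lemma projDim_le_iff (M : A) (n : ℕ) : projDim P M ≤ n ↔ resolutionLE P n M := by
  refine ⟨fun h => ?_, fun h =>
    iInf₂_le (f := fun (n : ℕ) (_ : HasLeftResolutionOfLength P M n) => (n : ℕ∞)) n
      (hasLeftResolutionOfLength_of_resolutionLE h)⟩
  obtain ⟨m, hm, hmn⟩ : ∃ m, HasLeftResolutionOfLength P M m ∧ m ≤ n := by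
    by_contra! h'
    have : ((n + 1 : ℕ) : ℕ∞) ≤ projDim P M :=
      le_iInf₂ fun m hm => Nat.cast_le.2 (h' m hm)
    exact absurd (Nat.cast_le.1 (this.trans h)) (Nat.not_succ_le_self n)
  exact resolutionLE_mono hP hmn _ hm.resolutionLE

lemma injDimOf_le_iff (Q : ObjectProperty A) (n : ℕ) :
    injDimOf P Q ≤ n ↔ Q ≤ coresolutionLE P n :=
  iSup₂_le_iff.trans (forall₂_congr fun M _ => injDim_le_iff hP M n)

lemma projDimOf_le_iff (Q : ObjectProperty A) (n : ℕ) :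
    projDimOf P Q ≤ n ↔ Q ≤ resolutionLE P n :=
  iSup₂_le_iff.trans (forall₂_congr fun M _ => projDim_le_iff hP M n)

lemma injDimLE_eq (n : ℕ) : injDimLE P n = coresolutionLE P n :=
  funext fun M => propext (injDim_le_iff hP M n)

lemma projDimLE_eq (n : ℕ) : projDimLE P n = resolutionLE P n :=
  funext fun M => propext (projDim_le_iff hP M n)

end Dimension

variable {C D : ObjectProperty A}

/-! ### Proper resolutions by coinduction -/

section ProperResolutions

lemma LeftResolution.IsHomExact.tail {M : A} {R : LeftResolution M} (hR : R.IsHomExact D) :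
    R.tail.IsHomExact D := by
  intro Y hY
  obtain ⟨-, h₀, h₁⟩ := hR Y hY
  have key (f : Y ⟶ R.X 1) :
      f ≫ kernel.lift R.π (R.d 0) R.d_comp_π = 0 ↔ f ≫ R.d 0 = 0 := by
    rw [← cancel_mono (kernel.ι R.π), zero_comp, Category.assoc, R.lift_comp_ι]
  refine ⟨fun f => ?_, fun f => (key f).trans (h₁ 0 f), fun i => h₁ (i + 1)⟩
  obtain ⟨g, hg⟩ := (h₀ (f ≫ kernel.ι R.π)).1 (by simp)
  refine ⟨g, ?_⟩
  rw [← cancel_mono (kernel.ι R.π), ← hg]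
  exact (Category.assoc _ _ _).trans (congrArg (g ≫ ·) R.lift_comp_ι)

lemma properRes.exists_ses {M : A} (h : properRes D C M) :
    ∃ (K X : A) (i : K ⟶ X) (p : X ⟶ M) (w : i ≫ p = 0),
      (ShortComplex.mk i p w).ShortExact ∧ C X ∧ properRes D C K ∧
        ∀ Y, D Y → ∀ f : Y ⟶ M, ∃ g, g ≫ p = f := by
  obtain ⟨R, hR, hR'⟩ := h
  have := R.epi_π
  exact ⟨kernel R.π, R.X 0, kernel.ι R.π, R.π, kernel.condition _,
    shortExact_of_lift _ _ _ fun g hg => ⟨kernel.lift _ g hg, kernel.lift_ι _ _ _⟩,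
    hR 0, ⟨R.tail, fun k => hR (k + 1), hR'.tail⟩, fun Y hY => (hR' Y hY).1⟩

/-- A class of objects each of which is the target of a `D`-proper epimorphism from an object
of `C` with kernel again in the class consists of objects with a proper resolution. -/
lemma le_properRes (W : ObjectProperty A)
    (h : ∀ V, W V → ∃ (K X : A) (i : K ⟶ X) (p : X ⟶ V) (w : i ≫ p = 0),
      (ShortComplex.mk i p w).ShortExact ∧ C X ∧ W K ∧
        ∀ Y, D Y → ∀ f : Y ⟶ V, ∃ g, g ≫ p = f) :
    W ≤ properRes D C := by
  intro V hV
  choose K X i p w hse hX hK hl using h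
  -- `s k` is the k-th iterated kernel bundled with its membership in W; the differential passes
  -- through `s (k + 1)`.
  let s (k : ℕ) : Subtype W := Nat.rec ⟨V, hV⟩ (fun _ t => ⟨K t.1 t.2, hK t.1 t.2⟩) k
  have hmono (t : Subtype W) : Mono (i t.1 t.2) := (hse t.1 t.2).mono_f
  have hepi (t : Subtype W) : Epi (p t.1 t.2) := (hse t.1 t.2).epi_g
  have hdπ (t : Subtype W) : (p (K t.1 t.2) (hK t.1 t.2) ≫ i t.1 t.2) ≫ p t.1 t.2 = 0 := by
    rw [Category.assoc, w, comp_zero]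
  have hex (t : Subtype W) :
      (ShortComplex.mk (p (K t.1 t.2) (hK t.1 t.2) ≫ i t.1 t.2) (p t.1 t.2) (hdπ t)).Exact :=
    have := hepi ⟨_, hK t.1 t.2⟩
    exact_comp_of_epi.2 (hse t.1 t.2).exact
  have hlift (t : Subtype W) {Y : A} (hY : D Y) (f : Y ⟶ X t.1 t.2) (hf : f ≫ p t.1 t.2 = 0) :
      ∃ g : Y ⟶ X (K t.1 t.2) (hK t.1 t.2), g ≫ p (K t.1 t.2) (hK t.1 t.2) ≫ i t.1 t.2 = f := by
    obtain ⟨f', rfl⟩ := exists_lift_of_shortExact (hse t.1 t.2) f hf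
    obtain ⟨g, rfl⟩ := hl _ (hK t.1 t.2) Y hY f'
    exact ⟨g, by simp⟩
  refine ⟨
    { X k := X (s k).1 (s k).2
      d k := p (s (k + 1)).1 (s (k + 1)).2 ≫ i (s k).1 (s k).2
      π := p V hV
      d_comp_π := hdπ (s 0)
      d_comp_d k := by
        have := hdπ (s (k + 1))
        exact (Category.assoc _ _ _).symm.trans ((congrArg (· ≫ _) this).trans zero_comp)
      epi_π := hepi (s 0)
      exact_zero := hex (s 0)
      exact_succ k := by
        have := hmono (s k)
        exact exact_comp_of_mono.2 (hex (s (k + 1))) }, fun k => hX _ _, fun Y hY =>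
    ⟨hl V hV Y hY, fun f => ⟨hlift (s 0) hY f, ?_⟩, fun k f => ⟨fun hf => ?_, ?_⟩⟩⟩
  · rintro ⟨g, rfl⟩
    exact (Category.assoc _ _ _).trans ((congrArg (g ≫ ·) (hdπ (s 0))).trans comp_zero)
  · have := hmono (s k)
    refine hlift (s (k + 1)) hY f ?_
    rw [← cancel_mono (i (s k).1 (s k).2), zero_comp, Category.assoc]
    exact hf
  · rintro ⟨g, rfl⟩
    dsimp only
    rw [Category.assoc, ← Category.assoc (_ ≫ _)]
    exact (congrArg (g ≫ ·) ((congrArg (· ≫ _) (hdπ (s (k + 1)))).trans zero_comp)).trans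
      comp_zero

end ProperResolutions

/-! ### Closure properties of C and of the orthogonal class -/

section Closure

lemma rightOrth_of_ses_mid {X Y Z : A} (h : SES X Y Z) (hX : rightOrth D X)
    (hZ : rightOrth D Z) : rightOrth D Y :=
  fun T hT i hi => h.ext_vanishes_mid (hX T hT i hi) (hZ T hT i hi)

/-- Properness is automatic: the obstruction to lifting lies in Ext^1(Y, K), which vanishes since
the kernel K is again in W. -/
lemma le_leftGorenstein (W : ObjectProperty A) (hW : W ≤ rightOrth D)
    (h : ∀ V, W V → ∃ K X : A, SES K X V ∧ C X ∧ W K) : W ≤ leftGorenstein C D := by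
  refine le_inf hW (le_properRes W fun V hV => ?_)
  obtain ⟨K, X, ⟨i, p, w, hs⟩, hX, hK⟩ := h V hV
  exact ⟨K, X, i, p, w, hs, hX, hK, fun Y hY f =>
    exists_lift_of_extVanishes hs (hW K hK Y hY 1 le_rfl) f⟩

lemma prop_biprod [C.IsClosedUnderFiniteProducts] [C.IsStableUnderRetracts] {X Y : A} (hX : C X) (hY : C Y) :
    C (X ⊞ Y) :=
  C.prop_of_iso (biprod.isoProd X Y).symm (C.prop_prod X Y hX hY)

lemma prop_of_ses [C.IsClosedUnderFiniteProducts] [C.IsStableUnderRetracts]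
    (hCD : C ≤ D ⊓ rightOrth D) {X Y Z : A} (h : SES X Y Z) (hX : C X)
    (hZ : C Z) : C Y := by
  obtain ⟨i, p, w, h⟩ := h
  obtain ⟨s, hs⟩ := exists_lift_of_extVanishes h
    ((hCD X hX).2 Z (hCD Z hZ).1 1 le_rfl) (𝟙 Z)
  have := h.mono_f
  have e := (ShortComplex.Splitting.ofExactOfSection _ h.exact s hs h.mono_f).isoBinaryBiproduct
  exact C.prop_of_iso e.symm (prop_biprod hX hZ)

end Closure

/-! ### The left Gorenstein subcategory and C-coresolutions -/

section LeftGorenstein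

open Abelian

attribute [local instance] HasExt.standard

/-- The kernel stays orthogonal to D: properness makes the connecting map into Ext^1(Y, K) zero, and
higher degrees follow by dimension shifting. -/
lemma leftGorenstein.exists_ses (hCD : C ≤ D ⊓ rightOrth D) {M : A}
    (hM : leftGorenstein C D M) : ∃ K X : A, SES K X M ∧ C X ∧ leftGorenstein C D K := by
  obtain ⟨K, X, i, p, w, h, hX, hK, hl⟩ := hM.2.exists_ses
  have hs : SES K X M := ⟨i, p, w, h⟩
  refine ⟨K, X, hs, hX, fun Y hY k hk => ?_, hK⟩
  have hYX := (hCD X hX).2 Y hY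
  match k, hk with
  | 1, _ =>
    have : ExtVanishes Y X 1 := hYX 1 le_rfl
    refine subsingleton_of_forall_eq 0 fun x => ?_
    obtain ⟨y, rfl⟩ := Ext.covariant_sequence_exact₁ Y h x (Subsingleton.elim _ _) (zero_add 1)
    obtain ⟨f, rfl⟩ := (Ext.mk₀_bijective _ _).2 y
    obtain ⟨g, rfl⟩ := hl Y hY f
    have hz : (Ext.mk₀ p).comp h.extClass (zero_add 1) = 0 := h.comp_extClass
    rw [← Ext.mk₀_comp_mk₀, Ext.comp_assoc_of_second_deg_zero]
    exact (congrArg ((Ext.mk₀ g).comp · (zero_add 1)) hz).trans (by simp)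
  | k + 2, _ =>
    exact hs.ext_vanishes_left (hM.1 Y hY (k + 1) (by lia)) (hYX (k + 2) (by lia))

lemma le_leftGorenstein_self [C.IsClosedUnderFiniteProducts] (hCD : C ≤ D ⊓ rightOrth D) :
    C ≤ leftGorenstein C D :=
  le_leftGorenstein C (fun X hX => (hCD X hX).2) fun V hV =>
    ⟨0, V, SES.of_isZero_left (isZero_zero A) (Iso.refl V), hV,
      C.prop_of_isTerminal _ (isZero_zero A).isTerminal⟩

/-- Ext^i(Z, G) sits between Ext^i(X, G) = 0 and Ext^{i+1}(W, G), W being the next cosyzygy. This is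
the source of the splittings below. -/
lemma extVanishes_of_coresolutionLE (hCD : C ≤ D ⊓ rightOrth D) {G : A} (hG : rightOrth D G) :
    ∀ {n : ℕ} {Z : A}, coresolutionLE C n Z → ∀ i, ExtVanishes Z G (i + 1)
  | 0, _, hZ, i => hG _ (hCD _ hZ).1 (i + 1) (Nat.le_add_left 1 i)
  | _ + 1, _, ⟨X, _, h, hX, hW⟩, i =>
    h.ext_vanishes_left' (hG X (hCD X hX).1 (i + 1) (Nat.le_add_left 1 i))
      (extVanishes_of_coresolutionLE hCD hG hW (i + 1))

lemma coresolutionLE_mono_length [C.IsClosedUnderFiniteProducts] {n m : ℕ} (hnm : n ≤ m) :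
    coresolutionLE C n ≤ coresolutionLE C m :=
  coresolutionLE_mono (fun _ h => C.prop_of_isTerminal _ h.isTerminal) hnm

lemma leftGorenstein_of_isZero [C.IsClosedUnderFiniteProducts] (hCD : C ≤ D ⊓ rightOrth D) {X : A} (hX : IsZero X) :
    leftGorenstein C D X :=
  le_leftGorenstein_self hCD X (C.prop_of_isTerminal _ hX.isTerminal)

variable [C.IsClosedUnderFiniteProducts] [C.IsStableUnderRetracts] (hCD : C ≤ D ⊓ rightOrth D)

include hCD

/-- The horseshoe lemma: an extension of two objects of the left Gorenstein subcategory is a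
quotient of an object of `C` by another such extension. -/
lemma exists_ses_of_extension {X Y Z : A} (h : SES X Y Z) (hX : leftGorenstein C D X)
    (hZ : leftGorenstein C D Z) :
    ∃ K X' K₁ K₂ : A, SES K X' Y ∧ C X' ∧ SES K₁ K K₂ ∧ leftGorenstein C D K₁ ∧
      leftGorenstein C D K₂ := by
  obtain ⟨K₁, C₁, h₁, hC₁, hK₁⟩ := hX.exists_ses hCD
  obtain ⟨K₂, C₂, h₂, hC₂, hK₂⟩ := hZ.exists_ses hCD
  -- F is an extension of C₂ by X; it splits, so it maps onto X with kernel C₂ and can be covered by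
  -- an extension E of C₁ by C₂.
  obtain ⟨F, hF₁, hF₂⟩ := h.pullback_epi h₂
  obtain ⟨E, hE₁, hE₂⟩ := h₁.pullback_epi
    (hF₁.symm_of_extVanishes (hX.1 C₂ (hCD C₂ hC₂).1 1 le_rfl))
  obtain ⟨K, hK, hK'⟩ := hE₁.pullback_mono hF₂
  exact ⟨K, E, K₁, K₂, hK', prop_of_ses hCD hE₂ hC₂ hC₁, hK, hK₁, hK₂⟩

lemma leftGorenstein_of_ses_mid {X Y Z : A} (h : SES X Y Z) (hX : leftGorenstein C D X)
    (hZ : leftGorenstein C D Z) : leftGorenstein C D Y := by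
  refine le_leftGorenstein (fun E => ∃ X Z : A, SES X E Z ∧ leftGorenstein C D X ∧
    leftGorenstein C D Z) ?_ ?_ Y ⟨X, Z, h, hX, hZ⟩
  · rintro E ⟨X, Z, h, hX, hZ⟩
    exact rightOrth_of_ses_mid h hX.1 hZ.1
  · rintro E ⟨X, Z, h, hX, hZ⟩
    obtain ⟨K, X', K₁, K₂, h₁, hX', h₂, hK₁, hK₂⟩ := exists_ses_of_extension hCD h hX hZ
    exact ⟨K, X', h₁, hX', K₁, K₂, h₂, hK₁, hK₂⟩

/-- An isomorphic copy is an extension by zero. -/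
lemma leftGorenstein_isClosedUnderIsomorphisms :
    (leftGorenstein C D).IsClosedUnderIsomorphisms where
  of_iso {_ _} e hX := leftGorenstein_of_ses_mid hCD (SES.of_isZero_right (isZero_zero A) e) hX
    (leftGorenstein_of_isZero hCD (isZero_zero A))

/-- Dual horseshoe: the pushout F splits because Ext^1(Z, C₁) = 0, so F, and with it Y, embeds into
an extension of C₁ by C₂. -/
lemma coresolutionLE_of_ses_mid :
    ∀ {n : ℕ} {X Y Z : A}, SES X Y Z → coresolutionLE C n X → coresolutionLE C n Z →
      coresolutionLE C n Y
  | 0, _, _, _, h, hX, hZ => prop_of_ses hCD h hX hZ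
  | n + 1, X, Y, Z, h, ⟨C₁, Z₁, h₁, hC₁, hZ₁⟩, hZ => by
    have hv := extVanishes_of_coresolutionLE hCD (hCD C₁ hC₁).2 hZ 0
    obtain ⟨C₂, Z₂, h₂, hC₂, hZ₂⟩ := hZ
    obtain ⟨F, hF₁, hF₂⟩ := h.pushout_mono h₁
    obtain ⟨E, hE₁, hE₂⟩ := (hF₂.symm_of_extVanishes hv).pushout_mono h₂
    obtain ⟨Z', hZ', hZ''⟩ := hE₁.pushout_epi hF₁
    exact ⟨E, Z', hZ'', prop_of_ses hCD hE₂ hC₂ hC₁, coresolutionLE_of_ses_mid hZ' hZ₁ hZ₂⟩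

lemma coresolutionLE_of_ses_right (hC : ClosedUnderCokernelsOfMonos C) :
    ∀ {n : ℕ} {X Y Z : A}, SES X Y Z → coresolutionLE C n X → coresolutionLE C n Y →
      coresolutionLE C n Z
  | 0, _, _, _, ⟨_, _, _, h⟩, hX, hY => hC _ h hX hY
  | n + 1, X, Y, Z, h, ⟨C₁, Z₁, h₁, hC₁, hZ₁⟩, hY => by
    obtain ⟨E, hE₁, hE₂⟩ := h.pushout_mono h₁
    obtain ⟨C₂, Z₂, h₂, hC₂, hZ₂⟩ := coresolutionLE_of_ses_mid (n := n + 1) hCD hE₁ hY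
      (coresolutionLE_mono_length n.le_succ _ hZ₁)
    obtain ⟨F, hF₁, i, p, w, hF₂⟩ := h₂.pushout_epi hE₂
    exact ⟨F, Z₂, hF₁, hC _ hF₂ hC₁ hC₂, hZ₂⟩

/-- An approximation: an object of finite left Gorenstein injective dimension is a quotient, by
an object of the left Gorenstein subcategory, of an object with a finite `C`-coresolution. -/
lemma exists_ses_of_coresolutionLE_leftGorenstein :
    ∀ {n : ℕ} {M : A}, coresolutionLE (leftGorenstein C D) n M →
      ∃ G X : A, SES G X M ∧ leftGorenstein C D G ∧ coresolutionLE C n X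
  | 0, M, hM => by
    obtain ⟨K, X, h, hX, hK⟩ := leftGorenstein.exists_ses hCD hM
    exact ⟨K, X, h, hK, hX⟩
  | n + 1, M, ⟨G₀, L, h, hG₀, hL⟩ => by
    obtain ⟨G, X, h', hG, hX⟩ := exists_ses_of_coresolutionLE_leftGorenstein hL
    obtain ⟨E, hE₁, hE₂⟩ := h.pullback_epi h'
    obtain ⟨K, C₀, h₀, hC₀, hK⟩ :=
      (leftGorenstein_of_ses_mid hCD hE₂ hG hG₀).exists_ses hCD
    obtain ⟨Y, hY₁, hY₂⟩ := h₀.pullback_mono hE₁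
    exact ⟨K, Y, hY₁, hK, C₀, X, hY₂, hC₀, hX⟩

lemma coresolutionLE_of_projective {n : ℕ} {P : A} [Projective P]
    (hP : coresolutionLE (leftGorenstein C D) n P) : coresolutionLE C n P := by
  obtain ⟨G, Y, h, hG, hY⟩ := exists_ses_of_coresolutionLE_leftGorenstein hCD hP
  have h' := h.symm_of_extVanishes (extVanishes_of_projective P G 0)
  -- The retraction Y → G lifts to the object X of C covering G, because Ext^1(Y, K) = 0; hence G is
  -- a retract of X.
  have hG' : C G := by
    obtain ⟨K, X, ⟨i, p, w, hs⟩, hX, hK⟩ := hG.exists_ses hCD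
    obtain ⟨j, q, w', h'⟩ := h
    have : Epi q := h'.epi_g
    let s := ShortComplex.Splitting.ofExactOfSection _ h'.exact (Projective.factorThru (𝟙 P) q)
      (Projective.factorThru_comp _ _) h'.mono_f
    obtain ⟨g, hg⟩ := exists_lift_of_extVanishes hs
      (extVanishes_of_coresolutionLE hCD hK.1 hY 0) s.r
    exact C.prop_of_retract
      { i := j ≫ g
        r := p
        retract := by rw [Category.assoc, hg]; exact s.f_r } hX
  match n, hY with
  | 0, hY =>
    obtain ⟨j, q, w', h'⟩ := h
    have : Epi q := h'.epi_g
    exact C.prop_of_retract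
      { i := Projective.factorThru (𝟙 P) q
        r := q
        retract := Projective.factorThru_comp _ _ } hY
  | n + 1, ⟨C₀, Z, h₀, hC₀, hZ⟩ =>
    -- Composing P → Y → C₀ gives a cokernel F that is an extension of Z by G, so no length is lost.
    obtain ⟨F, hF₁, hF₂⟩ := h₀.pushout_epi h'
    exact ⟨C₀, F, hF₂, hC₀, coresolutionLE_of_ses_mid hCD hF₁
      (coresolutionLE_mono_length n.zero_le _ hG') hZ⟩

end LeftGorenstein

/-! ### Cosyzygies -/

section Cosyzygies

attribute [local instance] HasExt.standard

/-- The `n`-th cosyzygies with respect to `P`: the objects `V` with an exact sequence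
`0 ⟶ M ⟶ X 0 ⟶ ⋯ ⟶ X (n - 1) ⟶ V ⟶ 0` with all `X i` in `P`. -/
def cosyzygy (P : ObjectProperty A) : ℕ → ObjectProperty A
  | 0 => ⊤
  | n + 1 => fun V => ∃ U X : A, SES U X V ∧ P X ∧ cosyzygy P n U

/-- Embedding into an injective raises the cosyzygy index by one; after k embeddings the hypothesis
ends the coresolution. The offset j is what the induction needs. -/
lemma coresolutionLE_of_cosyzygy_le [EnoughInjectives A] {P : ObjectProperty A}
    (hP : isInjective A ≤ P) : ∀ {k j : ℕ}, cosyzygy P (j + k) ≤ P →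
      cosyzygy P j ≤ coresolutionLE P k
  | 0, _, h => h
  | k + 1, j, h => fun M hM =>
    have hI : P (Injective.under M) := hP _ (inferInstanceAs (Injective (Injective.under M)))
    ⟨Injective.under M, _, SES.of_mono (Injective.ι M), hI,
      coresolutionLE_of_cosyzygy_le hP (j := j + 1)
        (by rwa [Nat.add_right_comm]) _ ⟨M, _, SES.of_mono (Injective.ι M), hI, hM⟩⟩

lemma extVanishes_of_cosyzygy {n : ℕ} {T : A} (hT : D T)
    (h : ∀ (M : A) (i : ℕ), n < i → ExtVanishes T M i) :
    ∀ {k : ℕ} {V : A}, cosyzygy (leftGorenstein C D) k V → ∀ i, 1 ≤ i → n < i + k →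
      ExtVanishes T V i
  | 0, V, _, i, _, hi => h V i hi
  | k + 1, _, ⟨_, _, hs, hX, hU⟩, i, hi, hi' =>
    hs.ext_vanishes_right (hX.1 T hT i hi)
      (extVanishes_of_cosyzygy hT h hU (i + 1) (by lia) (by lia))

variable [C.IsClosedUnderFiniteProducts] [C.IsStableUnderRetracts] (hCD : C ≤ D ⊓ rightOrth D)

include hCD

/-- Each cosyzygy step uses up one term of the C-coresolution of the covering object, so k + m stays
fixed; for m = 0 the cover lies in C. -/
lemma exists_ses_of_cosyzygy [EnoughProjectives A] :
    ∀ {k m : ℕ}, isProjective A ≤ coresolutionLE C (k + m) →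
      ∀ {V : A}, cosyzygy (leftGorenstein C D) k V →
        ∃ K Q : A, SES K Q V ∧ coresolutionLE C m Q ∧ cosyzygy (leftGorenstein C D) k K
  | 0, m, hP, V, _ => by
    rw [Nat.zero_add] at hP
    exact ⟨_, _, SES.of_epi (Projective.π V), hP _ (Projective.projective_over V), trivial⟩
  | k + 1, m, hP, V, ⟨U, G, h, hG, hU⟩ => by
    obtain ⟨L, Q, hQ, ⟨C₀, Z, hQ', hC₀, hZ⟩, hL⟩ :=
      exists_ses_of_cosyzygy (m := m + 1) (by rwa [Nat.add_right_comm] at hP) hU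
    obtain ⟨G', C', hG', hC', hGG'⟩ := hG.exists_ses hCD
    obtain ⟨U', hU₁, hU₂⟩ := hG'.pullback_mono h
    obtain ⟨T, hT₁, hT₂⟩ := hU₁.pullback_epi hQ
    -- T is an extension of Q by G' and splits. Pushing out along Q → C₀ embeds T in T', an
    -- extension of G' by C₀, hence in the Gorenstein class; so S = T'/L is a (k + 1)-st cosyzygy.
    have hv := extVanishes_of_coresolutionLE hCD hGG'.1
      (show coresolutionLE C (m + 1) Q from ⟨C₀, Z, hQ', hC₀, hZ⟩) 0
    obtain ⟨T', hT₁', hT₂'⟩ := (hT₁.symm_of_extVanishes hv).pushout_mono hQ'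
    obtain ⟨S, hS₁, hS₂⟩ := hT₁'.pushout_epi hT₂
    obtain ⟨Q', hQ₁', hQ₂'⟩ := hS₁.pushout_mono hU₂
    exact ⟨S, Q', hQ₁',
      coresolutionLE_of_ses_mid hCD hQ₂' (coresolutionLE_mono_length m.zero_le _ hC') hZ,
      L, T', hS₂, leftGorenstein_of_ses_mid hCD hT₂' (le_leftGorenstein_self hCD _ hC₀) hGG', hL⟩

end Cosyzygies

/-! ### Projective dimension and the two bounds -/

section ProjectiveDimension

attribute [local instance] HasExt.standard

lemma extVanishes_of_resolutionLE_projective (T : A) :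
    ∀ {n : ℕ} {M : A}, resolutionLE (isProjective A) n M → ∀ i, n < i → ExtVanishes M T i
  | 0, M, (hM : Projective M), i + 1, _ => extVanishes_of_projective M T i
  | n + 1, _, ⟨_, X, h, (hX : Projective X), hK⟩, i + 1, hi =>
    h.ext_vanishes_right' (extVanishes_of_resolutionLE_projective T hK i (by lia))
      (extVanishes_of_projective X T i)

lemma resolutionLE_projective_of_extVanishes [EnoughProjectives A] :
    ∀ {n : ℕ} {M : A}, (∀ T, ExtVanishes M T (n + 1)) → resolutionLE (isProjective A) n M
  | 0, _, h => projective_iff_subsingleton_ext_one.2 fun {T} => h T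
  | n + 1, M, h =>
    have hs := SES.of_epi (Projective.π M)
    ⟨_, _, hs, Projective.projective_over M, resolutionLE_projective_of_extVanishes fun T =>
      hs.ext_vanishes_left' (extVanishes_of_projective _ T n) (h T)⟩

/-- Shifting along a coresolution only raises the degree of Ext, so the bound n does not depend on
the length m. -/
lemma extVanishes_of_coresolutionLE_of_extVanishes (T : A) {n : ℕ}
    (hD : ∀ Y, D Y → ∀ i, n < i → ExtVanishes Y T i) :
    ∀ {m : ℕ} {M : A}, coresolutionLE D m M → ∀ i, n < i → ExtVanishes M T i
  | 0, _, hM, i, hi => hD _ hM i hi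
  | m + 1, _, ⟨X, _, h, hX, hZ⟩, i, hi =>
    h.ext_vanishes_left' (hD X hX i hi)
      (extVanishes_of_coresolutionLE_of_extVanishes T hD hZ (i + 1) (by lia))

lemma coresolutionLE_le_resolutionLE_projective [EnoughProjectives A] {n : ℕ}
    (hD : D ≤ resolutionLE (isProjective A) n) (m : ℕ) :
    coresolutionLE D m ≤ resolutionLE (isProjective A) n :=
  fun _ hM => resolutionLE_projective_of_extVanishes fun T =>
    extVanishes_of_coresolutionLE_of_extVanishes T
      (fun _ hY => extVanishes_of_resolutionLE_projective T (hD _ hY)) hM _ n.lt_succ_self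

lemma extVanishes_of_coresolutionLE_leftGorenstein {Y : A} (hY : D Y) :
    ∀ {n : ℕ} {M : A}, coresolutionLE (leftGorenstein C D) n M → ∀ i, n < i → ExtVanishes Y M i
  | 0, _, hM, i, hi => hM.1 Y hY i hi
  | n + 1, _, ⟨_, _, h, hX, hZ⟩, i + 1, hi =>
    h.ext_vanishes_left
      (extVanishes_of_coresolutionLE_leftGorenstein hY hZ i (by lia))
      (hX.1 Y hY (i + 1) (by lia))

variable [C.IsClosedUnderFiniteProducts] [C.IsStableUnderRetracts] (hCD : C ≤ D ⊓ rightOrth D)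

include hCD

lemma cosyzygy_le_leftGorenstein [EnoughProjectives A] {n : ℕ}
    (hP : isProjective A ≤ coresolutionLE C n) (hD : D ≤ resolutionLE (isProjective A) n) :
    cosyzygy (leftGorenstein C D) n ≤ leftGorenstein C D := by
  refine le_leftGorenstein _ (fun V hV T hT i hi => ?_) fun V hV =>
    exists_ses_of_cosyzygy (m := 0) hCD hP hV
  exact extVanishes_of_cosyzygy hT
    (fun M => extVanishes_of_resolutionLE_projective M (hD T hT)) hV i hi (by lia)

lemma coresolutionLE_leftGorenstein [EnoughProjectives A] [EnoughInjectives A]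
    (hI : isInjective A ≤ leftGorenstein C D) {n : ℕ}
    (hP : isProjective A ≤ coresolutionLE C n) (hD : D ≤ resolutionLE (isProjective A) n) (M : A) :
    coresolutionLE (leftGorenstein C D) n M :=
  coresolutionLE_of_cosyzygy_le hI (j := 0)
    (by rw [Nat.zero_add]; exact cosyzygy_le_leftGorenstein hCD hP hD) M trivial

/-- Passing to cokernels does not lengthen C-coresolutions, so the bound n persists through the
whole projective resolution. -/
lemma resolutionLE_le_coresolutionLE (hC : ClosedUnderCokernelsOfMonos C) {n : ℕ}
    (hP : isProjective A ≤ coresolutionLE C n) :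
    ∀ m, resolutionLE (isProjective A) m ≤ coresolutionLE C n
  | 0 => hP
  | m + 1 => fun _ ⟨K, X, h, hX, hK⟩ => coresolutionLE_of_ses_right hCD hC h
      (resolutionLE_le_coresolutionLE hC hP m K hK) (hP X hX)

end ProjectiveDimension

lemma coresolutionLE_le_of_le {P Q : ObjectProperty A} (h : P ≤ Q) :
    ∀ n, coresolutionLE P n ≤ coresolutionLE Q n
  | 0 => h
  | n + 1 => fun _ ⟨X, Z, hs, hX, hZ⟩ => ⟨X, Z, hs, h X hX, coresolutionLE_le_of_le h n Z hZ⟩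

lemma le_coresolutionLE {P : ObjectProperty A} (hP : ∀ M : A, IsZero M → P M) (n : ℕ) :
    P ≤ coresolutionLE P n :=
  coresolutionLE_mono hP n.zero_le

lemma le_resolutionLE {P : ObjectProperty A} (hP : ∀ M : A, IsZero M → P M) (n : ℕ) :
    P ≤ resolutionLE P n :=
  resolutionLE_mono hP n.zero_le

end RelativeGorenstein

/-! ### The equivalences -/

open RelativeGorenstein in
theorem theorem3p14 {A : Type u} [Category.{v} A] [Abelian A]
    [EnoughProjectives A] [EnoughInjectives A]
    [HasCoproducts.{v} A] [AB4 A] [HasProducts.{v} A] [AB4Star A]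
    (C D : ObjectProperty A)
    [C.IsClosedUnderFiniteProducts] [C.IsStableUnderRetracts] [D.IsClosedUnderIsomorphisms]
    (hCD : C ≤ D ⊓ rightOrth D)
    (hI : isInjective A ≤ leftGorenstein C D)
    (n : ℕ) :
    -- (4) implies (1)
    ((injDimLE D n = projDimLE (isProjective A) n ∧
        projDimLE (isProjective A) n = injDimLE C n) →
      IsLeftGorensteinCategory n C D) ∧
    -- (1), (2) and (3) are equivalent
    [ IsLeftGorensteinCategory n C D,
      ∀ M : A, injDim (leftGorenstein C D) M ≤ (n : ℕ∞),
      injDimOf (leftGorenstein C D) (isProjective A) ≤ (n : ℕ∞) ∧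
        projDimOf (isProjective A) D ≤ (n : ℕ∞) ].TFAE ∧
    -- (5) implies (3)
    ((injDimLE D n ≤ projDimLE (isProjective A) n ∧
        projDimLE (isProjective A) n ≤ injDimLE (leftGorenstein C D) n) →
      injDimOf (leftGorenstein C D) (isProjective A) ≤ (n : ℕ∞) ∧
        projDimOf (isProjective A) D ≤ (n : ℕ∞)) ∧
    -- (i): (1), (2), (3) and (4) are equivalent
    (ClosedUnderCokernelsOfMonos C →
      [ IsLeftGorensteinCategory n C D,
        ∀ M : A, injDim (leftGorenstein C D) M ≤ (n : ℕ∞),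
        injDimOf (leftGorenstein C D) (isProjective A) ≤ (n : ℕ∞) ∧
          projDimOf (isProjective A) D ≤ (n : ℕ∞),
        injDimLE D n = projDimLE (isProjective A) n ∧
          projDimLE (isProjective A) n = injDimLE C n ].TFAE) ∧
    -- (ii): (1), (2), (3) and (5) are equivalent
    (IsPreenveloping (leftGorenstein C D) → IsCoresolving (leftGorenstein C D) →
      [ IsLeftGorensteinCategory n C D,
        ∀ M : A, injDim (leftGorenstein C D) M ≤ (n : ℕ∞),
        injDimOf (leftGorenstein C D) (isProjective A) ≤ (n : ℕ∞) ∧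
          projDimOf (isProjective A) D ≤ (n : ℕ∞),
        injDimLE D n ≤ projDimLE (isProjective A) n ∧
          projDimLE (isProjective A) n ≤ injDimLE (leftGorenstein C D) n ].TFAE) := by
  have hC₀ : ∀ M : A, IsZero M → C M := fun M hM => C.prop_of_isTerminal M hM.isTerminal
  have hD₀ : ∀ M : A, IsZero M → D M := fun M hM => (hCD M (hC₀ M hM)).1
  have hG₀ : ∀ M : A, IsZero M → leftGorenstein C D M :=
    fun M hM => leftGorenstein_of_isZero hCD hM
  have hP₀ : ∀ M : A, IsZero M → isProjective A M := fun M hM => ⟨fun _ _ _ =>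
    ⟨0, hM.eq_of_src _ _⟩⟩
  have := leftGorenstein_isClosedUnderIsomorphisms hCD
  have : (isProjective A).IsClosedUnderIsomorphisms := ⟨fun e h => Projective.of_iso e h⟩
  simp only [IsLeftGorensteinCategory, injDimOf_le_iff hC₀, injDimOf_le_iff hG₀,
    projDimOf_le_iff hP₀, injDim_le_iff hG₀, injDimLE_eq hC₀, injDimLE_eq hD₀, injDimLE_eq hG₀,
    projDimLE_eq hP₀]
  have h₁₂ : (isProjective A ≤ coresolutionLE C n ∧ D ≤ resolutionLE (isProjective A) n) →
      ∀ M, coresolutionLE (leftGorenstein C D) n M :=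
    fun h => coresolutionLE_leftGorenstein hCD hI h.1 h.2
  have h₂₃ : (∀ M, coresolutionLE (leftGorenstein C D) n M) →
      isProjective A ≤ coresolutionLE (leftGorenstein C D) n ∧
        D ≤ resolutionLE (isProjective A) n :=
    fun h => ⟨fun P _ => h P, fun Y hY => resolutionLE_projective_of_extVanishes fun T =>
      extVanishes_of_coresolutionLE_leftGorenstein hY (h T) _ n.lt_succ_self⟩
  have h₃₁ : (isProjective A ≤ coresolutionLE (leftGorenstein C D) n ∧
        D ≤ resolutionLE (isProjective A) n) →
      isProjective A ≤ coresolutionLE C n ∧ D ≤ resolutionLE (isProjective A) n :=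
    fun h => ⟨fun P (hP : Projective P) => coresolutionLE_of_projective hCD (h.1 P hP), h.2⟩
  have h₄₁ : (coresolutionLE D n = resolutionLE (isProjective A) n ∧
        resolutionLE (isProjective A) n = coresolutionLE C n) →
      isProjective A ≤ coresolutionLE C n ∧ D ≤ resolutionLE (isProjective A) n :=
    fun h => ⟨h.2 ▸ le_resolutionLE hP₀ n, h.1 ▸ le_coresolutionLE hD₀ n⟩
  have h₅₃ : (coresolutionLE D n ≤ resolutionLE (isProjective A) n ∧
        resolutionLE (isProjective A) n ≤ coresolutionLE (leftGorenstein C D) n) →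
      isProjective A ≤ coresolutionLE (leftGorenstein C D) n ∧
        D ≤ resolutionLE (isProjective A) n :=
    fun h => ⟨(le_resolutionLE hP₀ n).trans h.2, (le_coresolutionLE hD₀ n).trans h.1⟩
  refine ⟨h₄₁, ?_, h₅₃, fun hC => ?_, fun _ _ => ?_⟩
  · tfae_have 1 → 2 := h₁₂
    tfae_have 2 → 3 := h₂₃
    tfae_have 3 → 1 := h₃₁
    tfae_finish
  · tfae_have 1 → 2 := h₁₂
    tfae_have 2 → 3 := h₂₃
    tfae_have 3 → 1 := h₃₁
    tfae_have 4 → 1 := h₄₁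
    tfae_have 1 → 4 := fun h => by
      -- The three classes are included in one another cyclically, hence are equal.
      have hDP := coresolutionLE_le_resolutionLE_projective h.2 n
      have hPC := resolutionLE_le_coresolutionLE hCD hC h.1 n
      have hC_D := coresolutionLE_le_of_le (fun X hX => (hCD X hX).1 : C ≤ D) n
      exact ⟨hDP.antisymm (hPC.trans hC_D), hPC.antisymm (hC_D.trans hDP)⟩
    tfae_finish
  · tfae_have 1 → 2 := h₁₂
    tfae_have 2 → 3 := h₂₃
    tfae_have 3 → 1 := h₃₁
    tfae_have 4 → 3 := h₅₃
    tfae_have 1 → 4 := fun h =>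
      ⟨coresolutionLE_le_resolutionLE_projective h.2 n, fun M _ => h₁₂ h M⟩
    tfae_finish
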